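/- For each $n=1,2,\dots$ let $\mathcal H_n^A$ and $\mathcal H_n^B$ be finite-dimensional complex Hilbert spaces and let $\psi_n,\phi_n\in\mathcal H_n^A\otimes\mathcal H_n^B$ be unit vectors (bipartite pure states), with reduced density operators $\psi_n^A=\mathrm{Tr}_B|\psi_n\rangle\langle\psi_n|$ and $\phi_n^A=\mathrm{Tr}_B|\phi_n\rangle\langle\phi_n|$. For a Hermitian operator $X$ let $\{X>0\}$ be the spectral projection of $X$ onto its eigenspaces with positive eigenvalues. For a sequence $\widehat\rho=\{\rho_n\}_{n\ge1}$ of density operators define the inf- and sup-spectral entropy rates, with values in $[-\infty,\infty]$, by $$\underline H(\widehat\rho)=-\inf\Bigl\{a\in\mathbb R : \limsup_{n\to\infty}\mathrm{Tr}\,\rho_n\{\rho_n-e^{na}I_n>0\}\le 0\Bigr\},$$ $$\overline H(\widehat\rho)=-\sup\Bigl\{a\in\mathbb R : \liminf_{n\to\infty}\mathrm{Tr}\,\rho_n\{\rho_n-e^{na}I_n>0\}\ge 1\Bigr\},$$ where $I_n$ is the identity operator on the space of $\rho_n$. An LOCC map is a map carried out by a protocol with finitely many rounds, in each of which one of the two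 parties performs a quantum measurement on its own system (possibly with ancillas), with finitely many outcomes, and communicates the outcome to the other party; the later steps may depend on all the earlier outcomes. Theorem (direct part). If $\underline H(\{\psi_n^A\}_n)>\overline H(\{\phi_n^A\}_n)$, then there is a sequence of LOCC maps $\mathcal L_n$ from operators on $\mathcal H_n^A\otimes\mathcal H_n^B$ to operators on $\mathcal H_n^A\otimes\mathcal H_n^B$ $(n=1,2,\dots)$ such that $$\lim_{n\to\infty}\bigl\|\mathcal L_n(|\psi_n\rangle\langle\psi_n|)-|\phi_n\rangle\langle\phi_n|\bigr\|_1=0,$$ where $\|X\|_1=\mathrm{Tr}|X|$ is the trace norm. -/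

import Mathlib

open Filter Topology Matrix
open scoped Kronecker

noncomputable section

namespace EntanglementConversion

/-- The density operator `|ψ⟩⟨ψ|` of a vector `ψ`. -/
def pureDensity {ι : Type*} (ψ : EuclideanSpace ℂ ι) : Matrix ι ι ℂ :=
  Matrix.of fun i j => ψ i * star (ψ j)

/-- The reduced operator `Tr_B ρ` on the first factor. -/
def reducedA {α β : Type*} [Fintype β] (ρ : Matrix (α × β) (α × β) ℂ) : Matrix α α ℂ :=
  Matrix.of fun i j => ∑ k, ρ (i, k) (j, k)

/-- The trace norm `‖A‖₁ = Tr |A|`, where `|A| = √(A† A)`. -/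
def traceNorm {ι : Type*} [Fintype ι] [DecidableEq ι] (A : Matrix ι ι ℂ) : ℝ :=
  (Matrix.trace (cfc Real.sqrt (Aᴴ * A))).re

/-- The spectral projection `{A > 0}` of a Hermitian matrix `A` onto the sum of its eigenspaces
with positive eigenvalues. The functional calculus accepts this step function because the
spectrum is finite. -/
def posProj {ι : Type*} [Fintype ι] [DecidableEq ι] (A : Matrix ι ι ℂ) : Matrix ι ι ℂ :=
  cfc (Set.indicator (Set.Ioi (0 : ℝ)) 1) A

/-- `Tr ρ_n {ρ_n - e^{na} σ_n > 0}`, the quantity that defines the spectral divergence rates. -/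
def spectralProb {d : ℕ → ℕ} (ρ σ : ∀ n, Matrix (Fin (d n)) (Fin (d n)) ℂ) (a : ℝ) (n : ℕ) : ℝ :=
  (Matrix.trace (ρ n * posProj (ρ n - Real.exp (n * a) • σ n))).re

/-- The spectral inf-divergence rate, a supremum of real numbers `a` taken in `[-∞, ∞]`. -/
def infDivergenceRate (ε : ℝ) {d : ℕ → ℕ} (ρ σ : ∀ n, Matrix (Fin (d n)) (Fin (d n)) ℂ) : EReal :=
  sSup ((fun a : ℝ => (a : EReal)) ''
    {a : ℝ | ((1 - ε : ℝ) : EReal) ≤ liminf (fun n => (spectralProb ρ σ a n : EReal)) atTop})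

/-- The spectral sup-divergence rate, an infimum of real numbers `a` taken in `[-∞, ∞]`. -/
def supDivergenceRate (ε : ℝ) {d : ℕ → ℕ} (ρ σ : ∀ n, Matrix (Fin (d n)) (Fin (d n)) ℂ) : EReal :=
  sInf ((fun a : ℝ => (a : EReal)) ''
    {a : ℝ | limsup (fun n => (spectralProb ρ σ a n : EReal)) atTop ≤ (ε : EReal)})

/-- The inf-spectral entropy rate: minus the sup-divergence rate relative to the identities. -/
def infEntropyRate (ε : ℝ) {d : ℕ → ℕ} (ρ : ∀ n, Matrix (Fin (d n)) (Fin (d n)) ℂ) : EReal :=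
  -supDivergenceRate ε ρ (fun _ => 1)

/-- The sup-spectral entropy rate: minus the inf-divergence rate relative to the identities. -/
def supEntropyRate (ε : ℝ) {d : ℕ → ℕ} (ρ : ∀ n, Matrix (Fin (d n)) (Fin (d n)) ℂ) : EReal :=
  -infDivergenceRate ε ρ (fun _ => 1)

/-- `IsLOCC F`: the map `F` from operators on `ℂ^a ⊗ ℂ^b` to operators on `ℂ^c ⊗ ℂ^d` is carried
out by a finite-round LOCC protocol. Either nothing is left to do, or one party performs a local
measurement with Kraus operators `K i`, where `∑ i, K i† K i = 1`, communicates the outcome `i`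
(the state then being `(K i ⊗ 1) ρ (K i ⊗ 1)†` up to its probability), and the parties continue
with an LOCC protocol `L i` that may depend on `i`. Averaging over the outcomes gives `F`.
Local ancillas are covered since `K i` may change the local dimension, and local channels
(discarding a subsystem, forgetting an outcome) are covered by letting `L i` not depend on `i`. -/
inductive IsLOCC {c d : ℕ} : ∀ {a b : ℕ},
    (Matrix (Fin a × Fin b) (Fin a × Fin b) ℂ → Matrix (Fin c × Fin d) (Fin c × Fin d) ℂ) → Prop
  | nil : IsLOCC (a := c) (b := d) (fun ρ => ρ)
  | alice {a b a' k : ℕ} (K : Fin k → Matrix (Fin a') (Fin a) ℂ)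
      (hK : ∑ i, (K i)ᴴ * K i = 1)
      (L : Fin k → Matrix (Fin a' × Fin b) (Fin a' × Fin b) ℂ →
        Matrix (Fin c × Fin d) (Fin c × Fin d) ℂ)
      (hL : ∀ i, IsLOCC (L i)) :
      IsLOCC (a := a) (b := b) (fun ρ => ∑ i, L i
        ((K i ⊗ₖ (1 : Matrix (Fin b) (Fin b) ℂ)) * ρ * (K i ⊗ₖ (1 : Matrix (Fin b) (Fin b) ℂ))ᴴ))
  | bob {a b b' k : ℕ} (K : Fin k → Matrix (Fin b') (Fin b) ℂ)
      (hK : ∑ i, (K i)ᴴ * K i = 1)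
      (L : Fin k → Matrix (Fin a × Fin b') (Fin a × Fin b') ℂ →
        Matrix (Fin c × Fin d) (Fin c × Fin d) ℂ)
      (hL : ∀ i, IsLOCC (L i)) :
      IsLOCC (a := a) (b := b) (fun ρ => ∑ i, L i
        (((1 : Matrix (Fin a) (Fin a) ℂ) ⊗ₖ K i) * ρ * ((1 : Matrix (Fin a) (Fin a) ℂ) ⊗ₖ K i)ᴴ))

/-- The sequence `ψ` of bipartite pure states can be asymptotically converted into the sequence
`φ` by LOCC. -/
def AsympConvertible {dA dB : ℕ → ℕ}
    (ψ φ : ∀ n, EuclideanSpace ℂ (Fin (dA n) × Fin (dB n))) : Prop :=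
  ∃ L : ∀ n, Matrix (Fin (dA n) × Fin (dB n)) (Fin (dA n) × Fin (dB n)) ℂ →
      Matrix (Fin (dA n) × Fin (dB n)) (Fin (dA n) × Fin (dB n)) ℂ,
    (∀ n, IsLOCC (L n)) ∧
    Tendsto (fun n => traceNorm (L n (pureDensity (ψ n)) - pureDensity (φ n))) atTop (𝓝 0)

end EntanglementConversion

end

/-!
# Asymptotic entanglement conversion from a gap of spectral entropy rates

The entropy gap gives exponents `x < y` such that, asymptotically, all of the Schmidt weight of
`ψ n` sits on squared Schmidt coefficients at most `exp (n x)`, and all of that of `φ n` on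
coefficients above `exp (n y)` (`exists_exponents_of_supEntropyRate_lt`). Truncate both vectors to
these coefficients and normalise (`exists_truncation`). The truncation of `φ n` has at most
`r ≤ exp (-n y)` nonzero coefficients, while those of the truncation of `ψ n` are at most about
`exp (n x)`, which is eventually much smaller than `exp (n y) ≤ 1 / r`. A probability vector bounded
by `1 / r` is majorized by every probability vector supported on `r` points; here an explicit doubly
stochastic matrix and Birkhoff's theorem write the first as a mixture of permutations of the second
(`exists_perm_mixture`).

Such a mixture gives an exact one-way protocol between the truncations, as in Nielsen's theorem
(`exists_kraus_of_perm_mixture`): Alice measures, one outcome for each permutation, after which her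
reduced state is that of the target, and Bob applies the unitary that matches the purifications
(`exists_unitary_mul_eq`). Vectors are handled through their coefficient matrices `X`, with reduced
operator `X X†`, so only this Hermitian operator has to be diagonalised.

Run on `ψ n` itself, the protocol produces branch vectors that are close, in the sum of squares, to
the corresponding multiples of `φ n`, because `∑ σ, ‖(K σ ⊗ W σ) x‖² = ‖x‖²`. The estimate
`sq_traceNorm_sum_pureDensity_sub_le` turns this into a bound on the trace norm, which gives the
one-shot statement `exists_isLOCC_sq_traceNorm_le` with error `4 √(ε + δ)` in terms of the truncated
weights.
-/

namespace EntanglementConversion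

/-! ### Trace norm and spectral projections through eigenvalues -/

section Spectral

variable {ι : Type*} [Fintype ι] [DecidableEq ι]

theorem trace_cfc {A : Matrix ι ι ℂ} (hA : A.IsHermitian) (f : ℝ → ℝ) :
    (cfc f A).trace = ∑ i, (f (hA.eigenvalues i) : ℂ) := by
  rw [hA.cfc_eq, Matrix.IsHermitian.cfc, Unitary.conjStarAlgAut_apply, Matrix.trace_mul_cycle]
  simp [Matrix.trace]

theorem traceNorm_eq_sum_abs_eigenvalues {A : Matrix ι ι ℂ} (hA : A.IsHermitian) :
    traceNorm A = ∑ i, |hA.eigenvalues i| := by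
  have h : cfc Real.sqrt (Aᴴ * A) = cfc (fun x : ℝ => |x|) A := by
    have hsa : IsSelfAdjoint A := hA
    have h2 : Aᴴ * A = cfc (fun x : ℝ => x ^ 2) A := by
      rw [cfc_pow_id A 2, hA.eq, sq]
    rw [h2, ← cfc_comp' Real.sqrt (fun x : ℝ => x ^ 2) A]
    simp only [Real.sqrt_sq_eq_abs]
  rw [traceNorm, h, trace_cfc hA]
  simp

theorem re_trace_mul_posProj_sub {A : Matrix ι ι ℂ} (hA : A.IsHermitian) (c : ℝ) :
    (A * posProj (A - c • (1 : Matrix ι ι ℂ))).trace.re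
      = ∑ i, if c < hA.eigenvalues i then hA.eigenvalues i else 0 := by
  have hsa : IsSelfAdjoint A := hA
  have hfin : (spectrum ℝ A).Finite := A.finite_real_spectrum
  have hsub : A - c • (1 : Matrix ι ι ℂ) = cfc (fun x : ℝ => x - c) A := by
    rw [cfc_sub (fun x : ℝ => x) (fun _ => c) A, cfc_id' ℝ A, cfc_const c A,
      Algebra.algebraMap_eq_smul_one]
  have hpos : posProj (A - c • (1 : Matrix ι ι ℂ))
      = cfc (fun x : ℝ => (Set.Ioi (0 : ℝ)).indicator 1 (x - c)) A := by
    rw [posProj, hsub, ← cfc_comp' _ (fun x : ℝ => x - c) A ((hfin.image _).continuousOn _)]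
  have hmul : A * posProj (A - c • (1 : Matrix ι ι ℂ))
      = cfc (fun x : ℝ => x * (Set.Ioi (0 : ℝ)).indicator 1 (x - c)) A := by
    rw [cfc_mul (fun x : ℝ => x) _ A (hfin.continuousOn _) (hfin.continuousOn _), cfc_id' ℝ A, hpos]
  rw [hmul, trace_cfc hA, ← Complex.ofReal_sum, Complex.ofReal_re]
  refine Finset.sum_congr rfl fun i _ => ?_
  simp [Set.indicator_apply]

omit [Fintype ι] [DecidableEq ι] in
theorem isHermitian_pureDensity (v : EuclideanSpace ℂ ι) : (pureDensity v).IsHermitian := by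
  ext i j
  simp [pureDensity, mul_comm]

omit [DecidableEq ι] in
theorem star_dotProduct_pureDensity_mulVec (e v : EuclideanSpace ℂ ι) :
    star e.ofLp ⬝ᵥ pureDensity v *ᵥ e.ofLp = ((‖inner ℂ e v‖ ^ 2 : ℝ) : ℂ) := by
  have h : pureDensity v = vecMulVec v.ofLp (star v.ofLp) := rfl
  rw [h, vecMulVec_mulVec, dotProduct_smul, EuclideanSpace.inner_eq_star_dotProduct,
    ← Complex.normSq_eq_norm_sq, Complex.normSq_eq_conj_mul_self]
  simp only [MulOpposite.smul_eq_mul_unop, MulOpposite.unop_op, dotProduct, Pi.star_apply,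
    map_sum, map_mul]
  rw [mul_comm]
  simp [mul_comm]

/-- A square-root continuity bound for mixtures of (unnormalised) pure states. It plays the role
of the contractivity of the trace norm under LOCC: applied to the outcome branches of a protocol,
it bounds the error by the distances of the branch vectors. -/
theorem sq_traceNorm_sum_pureDensity_sub_le {κ : Type*} [Fintype κ]
    (v w : κ → EuclideanSpace ℂ ι) :
    traceNorm (∑ j, pureDensity (v j) - ∑ j, pureDensity (w j)) ^ 2
      ≤ 2 * (∑ j, ‖v j‖ ^ 2 + ∑ j, ‖w j‖ ^ 2) * ∑ j, ‖v j - w j‖ ^ 2 := by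
  have hA : (∑ j, pureDensity (v j) - ∑ j, pureDensity (w j)).IsHermitian := by
    refine Matrix.IsHermitian.sub ?_ ?_
    · exact isSelfAdjoint_sum _ fun j _ => isHermitian_pureDensity (v j)
    · exact isSelfAdjoint_sum _ fun j _ => isHermitian_pureDensity (w j)
  rw [traceNorm_eq_sum_abs_eigenvalues hA]
  set b := hA.eigenvectorBasis
  have hev : ∀ i, hA.eigenvalues i
      = ∑ j, (‖inner ℂ (b i) (v j)‖ ^ 2 - ‖inner ℂ (b i) (w j)‖ ^ 2) := by
    intro i
    rw [hA.eigenvalues_eq, Matrix.sub_mulVec, dotProduct_sub, Matrix.sum_mulVec,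
      Matrix.sum_mulVec, dotProduct_sum, dotProduct_sum]
    simp only [star_dotProduct_pureDensity_mulVec, ← Complex.ofReal_sum, ← Complex.ofReal_sub,
      Finset.sum_sub_distrib]
    exact Complex.ofReal_re _
  clear_value b
  set x : ι × κ → ℝ := fun z => ‖inner ℂ (b z.1) (v z.2)‖ + ‖inner ℂ (b z.1) (w z.2)‖
  set y : ι × κ → ℝ := fun z => ‖inner ℂ (b z.1) (v z.2 - w z.2)‖
  have h1 : ∑ i, |hA.eigenvalues i| ≤ ∑ z, x z * y z := by
    rw [Fintype.sum_prod_type]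
    refine Finset.sum_le_sum fun i _ => ?_
    rw [hev i]
    refine (Finset.abs_sum_le_sum_abs _ _).trans (Finset.sum_le_sum fun j _ => ?_)
    rw [sq_sub_sq, abs_mul, abs_of_nonneg (by positivity)]
    refine mul_le_mul_of_nonneg_left ?_ (by positivity)
    simp only [y, inner_sub_right]
    exact abs_norm_sub_norm_le _ _
  have hx : ∑ z, x z ^ 2 ≤ 2 * (∑ j, ‖v j‖ ^ 2 + ∑ j, ‖w j‖ ^ 2) := by
    rw [Fintype.sum_prod_type_right, ← Finset.sum_add_distrib, Finset.mul_sum]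
    refine Finset.sum_le_sum fun j _ => ?_
    rw [← b.sum_sq_norm_inner_right (v j), ← b.sum_sq_norm_inner_right (w j),
      ← Finset.sum_add_distrib, Finset.mul_sum]
    exact Finset.sum_le_sum fun i _ => add_sq_le
  have hy : ∑ z, y z ^ 2 = ∑ j, ‖v j - w j‖ ^ 2 := by
    rw [Fintype.sum_prod_type_right]
    exact Finset.sum_congr rfl fun j _ => b.sum_sq_norm_inner_right (v j - w j)
  have h0 : 0 ≤ ∑ i, |hA.eigenvalues i| := Finset.sum_nonneg fun i _ => abs_nonneg _
  have hcs : (∑ z, x z * y z) ^ 2 ≤ (∑ z, x z ^ 2) * ∑ z, y z ^ 2 :=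
    Finset.sum_mul_sq_le_sq_mul_sq _ _ _
  rw [← hy]
  refine (pow_le_pow_left₀ h0 h1 2).trans (hcs.trans ?_)
  exact mul_le_mul_of_nonneg_right hx (Finset.sum_nonneg fun z _ => sq_nonneg _)

end Spectral

/-! ### Mixtures of permutations -/

/-- A probability vector `p` bounded by `1 / |T|` is a mixture of permutations of every
probability vector `q` supported on `T`: this is `p ≺ q`, with an explicit doubly stochastic
matrix, followed by Birkhoff's theorem. -/
theorem exists_perm_mixture {ι : Type*} [Fintype ι] [DecidableEq ι] {p q : ι → ℝ} (T : Finset ι)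
    (hp : ∀ i, 0 ≤ p i) (hp1 : ∑ i, p i = 1) (hpT : ∀ i, T.card * p i ≤ 1)
    (hqT : ∀ i, i ∉ T → q i = 0) (hq1 : ∑ i, q i = 1) :
    ∃ t : Equiv.Perm ι → ℝ, (∀ σ, 0 ≤ t σ) ∧ ∑ σ, t σ = 1 ∧ ∀ i, ∑ σ, t σ * q (σ i) = p i := by
  classical
  -- The columns in `T` are copies of `p`; the others share equally what the rows still lack.
  let M : Matrix ι ι ℝ := of fun i j =>
    if j ∈ T then p i else (1 - T.card * p i) / (Tᶜ.card : ℝ)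
  have hcard : (T.card : ℝ) + Tᶜ.card = Fintype.card ι := by
    exact_mod_cast Finset.card_add_card_compl T
  have hM : M ∈ doublyStochastic ℝ ι := by
    refine mem_doublyStochastic_iff_sum.2 ⟨fun i j => ?_, fun i => ?_, fun j => ?_⟩
    · simp only [M, of_apply]
      split_ifs
      · exact hp i
      · exact div_nonneg (sub_nonneg.2 (hpT i)) (by positivity)
    · rw [← Finset.sum_add_sum_compl T]
      have h1 : ∑ j ∈ T, M i j = T.card * p i := by
        rw [Finset.sum_congr rfl (g := fun _ => p i) (fun j hj => by simp [M, hj])]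
        simp
      have h2 : ∑ j ∈ Tᶜ, M i j = Tᶜ.card * ((1 - T.card * p i) / (Tᶜ.card : ℝ)) := by
        rw [Finset.sum_congr rfl (g := fun _ => (1 - T.card * p i) / (Tᶜ.card : ℝ))
          (fun j hj => by simp [M, Finset.mem_compl.1 hj])]
        simp
      rw [h1, h2]
      rcases eq_or_ne (Tᶜ.card : ℝ) 0 with h0 | h0
      · -- If `T` is everything, then `p` is uniform: all the slacks `1 - |T| p i` vanish.
        have hs : ∑ i, (1 - T.card * p i) = 0 := by
          rw [Finset.sum_sub_distrib, ← Finset.mul_sum, hp1]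
          simp [← hcard, h0]
        have := (Finset.sum_eq_zero_iff_of_nonneg fun i _ => sub_nonneg.2 (hpT i)).1 hs i
          (Finset.mem_univ i)
        rw [h0]
        linarith
      · field_simp
        ring
    · by_cases hj : j ∈ T
      · simpa [M, hj] using hp1
      · have h0 : (Tᶜ.card : ℝ) ≠ 0 := by
          exact_mod_cast (Finset.card_pos.2 ⟨j, Finset.mem_compl.2 hj⟩).ne'
        simp only [M, of_apply, hj, if_false]
        rw [← Finset.sum_div, Finset.sum_sub_distrib, ← Finset.mul_sum, hp1, div_eq_one_iff_eq h0]
        simp [← hcard]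
  obtain ⟨t, ht, ht1, htM⟩ := exists_eq_sum_perm_of_mem_doublyStochastic hM
  refine ⟨t, ht, ht1, fun i => ?_⟩
  have hMq : (M *ᵥ q) i = p i := by
    have : ∀ j, M i j * q j = p i * q j := fun j => by
      by_cases hj : j ∈ T
      · simp [M, hj]
      · simp [hqT j hj]
    simp only [mulVec, dotProduct, this, ← Finset.mul_sum, hq1, mul_one]
  rw [← hMq, ← htM, Matrix.sum_mulVec, Finset.sum_apply]
  simp [Matrix.smul_mulVec, Matrix.permMatrix_mulVec]

/-! ### Purifications and LOCC protocols -/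

theorem exists_linearIsometry_comp_eq {E V : Type*} [AddCommGroup E] [Module ℂ E]
    [NormedAddCommGroup V] [InnerProductSpace ℂ V] [FiniteDimensional ℂ V] (f g : E →ₗ[ℂ] V)
    (h : ∀ x, ‖f x‖ = ‖g x‖) : ∃ T : V →ₗᵢ[ℂ] V, ∀ x, T (f x) = g x := by
  obtain ⟨s, hs⟩ := f.rangeRestrict.exists_rightInverse_of_surjective f.range_rangeRestrict
  have hs' : ∀ y : f.range, f (s y) = y := fun y => by
    simpa using congrArg Subtype.val (LinearMap.congr_fun hs y)
  let T₀ : f.range →ₗᵢ[ℂ] V :=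
    { toLinearMap := g ∘ₗ s
      norm_map' := fun y => by simp [← h, hs'] }
  refine ⟨T₀.extend, fun x => ?_⟩
  have hx : T₀.extend (f x) = g (s ⟨f x, x, rfl⟩) := T₀.extend_apply ⟨f x, x, rfl⟩
  rw [hx, ← sub_eq_zero, ← map_sub, ← norm_eq_zero, ← h, map_sub, hs']
  simp

/-- Two purifications of the same operator differ by a unitary on the purifying system. -/
theorem exists_unitary_mul_eq {m n : Type*} [Fintype m] [DecidableEq m] [Fintype n]
    [DecidableEq n] (X Y : Matrix m n ℂ) (h : X * Xᴴ = Y * Yᴴ) :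
    ∃ W : Matrix n n ℂ, W * Wᴴ = 1 ∧ X * W = Y := by
  have hn : ∀ (Z : Matrix m n ℂ) (x : EuclideanSpace ℂ m),
      ((‖toEuclideanLin Zᴴ x‖ ^ 2 : ℝ) : ℂ) = star x.ofLp ⬝ᵥ (Z * Zᴴ) *ᵥ x.ofLp := fun Z x => by
    have := inner_self_eq_norm_sq_to_K (𝕜 := ℂ) (toEuclideanLin Zᴴ x)
    rw [Complex.ofReal_pow]
    refine this.symm.trans ?_
    rw [EuclideanSpace.inner_eq_star_dotProduct, dotProduct_comm]
    simp only [toLpLin_apply, star_mulVec, conjTranspose_conjTranspose]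
    rw [← dotProduct_mulVec, mulVec_mulVec]
  obtain ⟨T, hT⟩ := exists_linearIsometry_comp_eq (toEuclideanLin Xᴴ) (toEuclideanLin Yᴴ)
    fun x => by
      refine (pow_left_inj₀ (norm_nonneg _) (norm_nonneg _) two_ne_zero).1 ?_
      exact_mod_cast (hn X x).trans ((congrArg _ (by rw [h])).trans (hn Y x).symm)
  let V : Matrix n n ℂ := toEuclideanLin.symm T.toLinearMap
  have hV : ∀ x, toEuclideanLin V x = T x := fun x => by simp [V]
  have hVV : Vᴴ * V = 1 := by
    apply toEuclideanLin.injective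
    ext1 x
    refine ext_inner_left ℂ fun y => ?_
    have h1 : toEuclideanLin (Vᴴ * V) x = toEuclideanLin Vᴴ (toEuclideanLin V x) := by
      simp [toLpLin_apply, mulVec_mulVec]
    rw [h1, toEuclideanLin_conjTranspose_eq_adjoint, LinearMap.adjoint_inner_right, hV, hV,
      T.inner_map_map]
    simp
  refine ⟨Vᴴ, by simpa using hVV, ?_⟩
  have h2 : V * Xᴴ = Yᴴ := by
    apply toEuclideanLin.injective
    ext1 x
    rw [← hT, ← hV]
    simp [toLpLin_apply, mulVec_mulVec]
  simpa using congrArg conjTranspose h2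

/-- The one-way protocol in which Alice measures `K`, announces the outcome `i`, and Bob applies
the unitary `W i`. -/
theorem isLOCC_measure_correct {a b : ℕ} {κ : Type*} [Fintype κ]
    (K : κ → Matrix (Fin a) (Fin a) ℂ) (W : κ → Matrix (Fin b) (Fin b) ℂ)
    (hK : ∑ i, (K i)ᴴ * K i = 1) (hW : ∀ i, (W i)ᴴ * W i = 1) :
    IsLOCC (a := a) (b := b) (c := a) (d := b)
      (fun ρ => ∑ i, (K i ⊗ₖ W i) * ρ * (K i ⊗ₖ W i)ᴴ) := by
  let e := (Fintype.equivFin κ).symm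
  have h := IsLOCC.alice (fun i => K (e i))
    (by rw [e.sum_comp (fun i => (K i)ᴴ * K i)]; exact hK) _
    fun i => IsLOCC.bob (a := a) (k := 1) (fun _ => W (e i)) (by simpa using hW (e i)) _
      fun _ => IsLOCC.nil
  convert h using 2 with ρ
  rw [← e.sum_comp]
  refine Finset.sum_congr rfl fun i _ => ?_
  have hKW : K (e i) ⊗ₖ W (e i) = ((1 : Matrix (Fin a) (Fin a) ℂ) ⊗ₖ W (e i))
      * (K (e i) ⊗ₖ (1 : Matrix (Fin b) (Fin b) ℂ)) := by
    rw [← mul_kronecker_mul, one_mul, mul_one]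
  rw [hKW]
  simp [conjTranspose_mul, Matrix.mul_assoc]

/-! ### Coefficient matrices of bipartite vectors -/

section Coefficients

variable {α β : Type*}

/-- The matrix of coefficients of a bipartite vector. Local operators `K ⊗ W` act on it by
`X ↦ K X Wᵀ`, and the reduced operator on the first factor is `X X†`. -/
def coeffMatrix (ψ : EuclideanSpace ℂ (α × β)) : Matrix α β ℂ :=
  of fun i k => ψ (i, k)

theorem coeffMatrix_injective :
    Function.Injective (coeffMatrix : EuclideanSpace ℂ (α × β) → Matrix α β ℂ) := by
  intro ψ φ h
  ext z
  exact congrFun (congrFun h z.1) z.2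

theorem coeffMatrix_surjective :
    Function.Surjective (coeffMatrix : EuclideanSpace ℂ (α × β) → Matrix α β ℂ) :=
  fun X => ⟨WithLp.toLp 2 fun z => X z.1 z.2, rfl⟩

theorem coeffMatrix_sub (ψ φ : EuclideanSpace ℂ (α × β)) :
    coeffMatrix (ψ - φ) = coeffMatrix ψ - coeffMatrix φ := rfl

theorem reducedA_pureDensity [Fintype β] (ψ : EuclideanSpace ℂ (α × β)) :
    reducedA (pureDensity ψ) = coeffMatrix ψ * (coeffMatrix ψ)ᴴ := by
  ext i j
  simp [reducedA, pureDensity, coeffMatrix, Matrix.mul_apply]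

variable [Fintype α] [Fintype β]

theorem norm_sq_eq_trace (ψ : EuclideanSpace ℂ (α × β)) :
    ((‖ψ‖ ^ 2 : ℝ) : ℂ) = (coeffMatrix ψ * (coeffMatrix ψ)ᴴ).trace := by
  rw [EuclideanSpace.norm_sq_eq, Fintype.sum_prod_type]
  simp [Matrix.trace, Matrix.mul_apply, coeffMatrix, Complex.mul_conj, Complex.normSq_eq_norm_sq]

theorem coeffMatrix_kronecker_mulVec (K : Matrix α α ℂ) (W : Matrix β β ℂ)
    (ψ : EuclideanSpace ℂ (α × β)) :
    coeffMatrix (WithLp.toLp 2 ((K ⊗ₖ W) *ᵥ ψ.ofLp)) = K * coeffMatrix ψ * Wᵀ := by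
  ext i k
  simp only [coeffMatrix, of_apply, mulVec, dotProduct, kroneckerMap_apply, Matrix.mul_apply,
    transpose_apply, Fintype.sum_prod_type, Finset.sum_mul]
  rw [Finset.sum_comm]
  exact Finset.sum_congr rfl fun _ _ => Finset.sum_congr rfl fun _ _ => by ring

end Coefficients

section Vectors

variable {ι : Type*} [Fintype ι]

theorem mul_pureDensity_mul (M : Matrix ι ι ℂ) (v : EuclideanSpace ℂ ι) :
    M * pureDensity v * Mᴴ = pureDensity (WithLp.toLp 2 (M *ᵥ v.ofLp)) := by
  have h : ∀ u : EuclideanSpace ℂ ι, pureDensity u = vecMulVec u.ofLp (star u.ofLp) :=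
    fun _ => rfl
  rw [h, h, mul_vecMulVec, vecMulVec_mul, star_mulVec]

omit [Fintype ι] in
theorem pureDensity_smul (c : ℝ) (v : EuclideanSpace ℂ ι) :
    pureDensity (c • v) = (c ^ 2) • pureDensity v := by
  ext i j
  simp only [pureDensity, of_apply, PiLp.smul_apply, Matrix.smul_apply, Complex.real_smul,
    star_mul', Complex.star_def, Complex.conj_ofReal]
  push_cast
  ring

theorem sum_norm_sq_mulVec [DecidableEq ι] {κ : Type*} [Fintype κ] (M : κ → Matrix ι ι ℂ)
    (hM : ∑ j, (M j)ᴴ * M j = 1) (v : EuclideanSpace ℂ ι) :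
    ∑ j, ‖(WithLp.toLp 2 (M j *ᵥ v.ofLp) : EuclideanSpace ℂ ι)‖ ^ 2 = ‖v‖ ^ 2 := by
  have hn : ∀ u : EuclideanSpace ℂ ι, ((‖u‖ ^ 2 : ℝ) : ℂ) = star u.ofLp ⬝ᵥ u.ofLp := fun u => by
    rw [Complex.ofReal_pow]
    refine (inner_self_eq_norm_sq_to_K (𝕜 := ℂ) u).symm.trans ?_
    rw [EuclideanSpace.inner_eq_star_dotProduct, dotProduct_comm]
  apply Complex.ofReal_injective
  rw [Complex.ofReal_sum, hn]
  simp only [hn, star_mulVec, ← dotProduct_mulVec, mulVec_mulVec]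
  rw [← dotProduct_sum, ← Matrix.sum_mulVec, hM, one_mulVec]

end Vectors

/-! ### Truncation and exact conversion -/

section OneShot

variable {α β : Type*} [Fintype α] [DecidableEq α] [Fintype β] [DecidableEq β]

omit [DecidableEq β] in
/-- Rescaling the Schmidt coefficients of `ψ` by real factors `f`, in its own Schmidt basis. -/
theorem exists_rescale {ψ : EuclideanSpace ℂ (α × β)} {U : Matrix α α ℂ} {p : α → ℝ}
    (hU : Uᴴ * U = 1)
    (hψ : coeffMatrix ψ * (coeffMatrix ψ)ᴴ = U * diagonal (fun i => (p i : ℂ)) * Uᴴ)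
    (f : α → ℝ) :
    ∃ ψ' : EuclideanSpace ℂ (α × β),
      coeffMatrix ψ' * (coeffMatrix ψ')ᴴ = U * diagonal (fun i => ((f i ^ 2 * p i : ℝ) : ℂ)) * Uᴴ ∧
      ‖ψ - ψ'‖ ^ 2 = ∑ i, (1 - f i) ^ 2 * p i := by
  have hU' : U * Uᴴ = 1 := mul_eq_one_comm.1 hU
  let D : (α → ℝ) → Matrix α α ℂ := fun g => U * diagonal (fun i => (g i : ℂ)) * Uᴴ
  have hD : ∀ g : α → ℝ, (D g * coeffMatrix ψ) * (D g * coeffMatrix ψ)ᴴ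
      = U * diagonal (fun i => ((g i ^ 2 * p i : ℝ) : ℂ)) * Uᴴ := fun g => by
    have hg : (D g)ᴴ = D g := by
      have : (diagonal fun i => (g i : ℂ))ᴴ = diagonal fun i => (g i : ℂ) := by
        rw [diagonal_conjTranspose]
        congr 1
        ext i
        simp
      simp only [D, conjTranspose_mul, conjTranspose_conjTranspose, this, Matrix.mul_assoc]
    calc _ = D g * (coeffMatrix ψ * (coeffMatrix ψ)ᴴ) * D g := by
          rw [conjTranspose_mul, hg]
          simp only [Matrix.mul_assoc]
      _ = U * diagonal (fun i => (g i : ℂ)) * (Uᴴ * U) * diagonal (fun i => (p i : ℂ))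
            * (Uᴴ * U) * diagonal (fun i => (g i : ℂ)) * Uᴴ := by
          rw [hψ]
          simp only [D, Matrix.mul_assoc]
      _ = _ := by
          rw [hU, mul_one, mul_one, Matrix.mul_assoc U, diagonal_mul_diagonal, Matrix.mul_assoc U,
            diagonal_mul_diagonal]
          congr 3
          ext i
          push_cast
          ring
  obtain ⟨ψ', hψ'⟩ := coeffMatrix_surjective (D f * coeffMatrix ψ)
  refine ⟨ψ', ?_, ?_⟩
  · rw [hψ', hD]
  · apply Complex.ofReal_injective
    rw [norm_sq_eq_trace]
    have hsub : coeffMatrix (ψ - ψ') = D (fun i => 1 - f i) * coeffMatrix ψ := by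
      have h1 : D (fun i => 1 - f i) = 1 - D f := by
        have : (diagonal fun i => ((1 - f i : ℝ) : ℂ)) = 1 - diagonal fun i => (f i : ℂ) := by
          rw [← diagonal_one, diagonal_sub]
          simp
        simp only [D, this, Matrix.mul_sub, Matrix.sub_mul, mul_one, hU']
      rw [coeffMatrix_sub, hψ', h1, Matrix.sub_mul, Matrix.one_mul]
    rw [hsub, hD, Matrix.trace_mul_cycle, hU, one_mul, trace_diagonal, Complex.ofReal_sum]

omit [DecidableEq β] in
/-- Projecting `ψ` on the Schmidt vectors indexed by `S`, which carry the weight `P`, and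
normalising moves it by at most `√(2 (1 - P))`. -/
theorem exists_truncation {ψ : EuclideanSpace ℂ (α × β)} {U : Matrix α α ℂ} {p : α → ℝ}
    (hU : Uᴴ * U = 1)
    (hψ : coeffMatrix ψ * (coeffMatrix ψ)ᴴ = U * diagonal (fun i => (p i : ℂ)) * Uᴴ)
    (hp : ∀ i, 0 ≤ p i) (hp1 : ∑ i, p i = 1) (S : Finset α) (hS : 0 < ∑ i ∈ S, p i) :
    ∃ ψ' : EuclideanSpace ℂ (α × β),
      coeffMatrix ψ' * (coeffMatrix ψ')ᴴ
        = U * diagonal (fun i => ((if i ∈ S then p i / ∑ k ∈ S, p k else 0 : ℝ) : ℂ)) * Uᴴ ∧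
      ‖ψ - ψ'‖ ^ 2 ≤ 2 * (1 - ∑ i ∈ S, p i) := by
  set P := ∑ i ∈ S, p i with hP
  have hP1 : P ≤ 1 := hp1 ▸ Finset.sum_le_univ_sum_of_nonneg hp
  have hs : 0 < √P := Real.sqrt_pos.2 hS
  have hsq : √P ^ 2 = P := Real.sq_sqrt hS.le
  obtain ⟨ψ', h1, h2⟩ := exists_rescale hU hψ fun i => if i ∈ S then (√P)⁻¹ else 0
  refine ⟨ψ', ?_, ?_⟩
  · rw [h1]
    congr 3
    ext i
    congr 1
    split_ifs
    · rw [inv_pow, hsq]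
      ring
    · simp
  · have h3 : ∑ i, (1 - if i ∈ S then (√P)⁻¹ else 0) ^ 2 * p i
        = (1 - (√P)⁻¹) ^ 2 * P + (1 - P) := by
      have hc : ∑ i ∈ Sᶜ, p i = 1 - P := by
        rw [← hp1, hP, ← Finset.sum_add_sum_compl S]
        ring
      rw [← Finset.sum_add_sum_compl S, ← hc, hP, Finset.mul_sum]
      congr 1
      · exact Finset.sum_congr rfl fun i hi => by simp [hi]
      · exact Finset.sum_congr rfl fun i hi => by simp [Finset.mem_compl.1 hi]
    have h4 : (1 - (√P)⁻¹) ^ 2 * P = (√P - 1) ^ 2 := by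
      nth_rw 2 [← hsq]
      field_simp
    have h5 : P ≤ √P := by
      rw [Real.le_sqrt hS.le hS.le]
      nlinarith
    rw [h2, h3, h4]
    nlinarith

/-- The exact conversion behind Nielsen's theorem. If the Schmidt vector `p` of `ψ` is the mixture
`∑ σ, t σ (q ∘ σ)` of permutations of the Schmidt vector `q` of `φ`, then Alice can measure Kraus
operators `K σ` after whose outcome `σ`, of probability `t σ`, Bob turns the state into `φ`. -/
theorem exists_kraus_of_perm_mixture {ψ φ : EuclideanSpace ℂ (α × β)} {U V : Matrix α α ℂ}
    {p q : α → ℝ} {t : Equiv.Perm α → ℝ} (hU : Uᴴ * U = 1) (hV : Vᴴ * V = 1)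
    (hψ : coeffMatrix ψ * (coeffMatrix ψ)ᴴ = U * diagonal (fun i => (p i : ℂ)) * Uᴴ)
    (hφ : coeffMatrix φ * (coeffMatrix φ)ᴴ = V * diagonal (fun i => (q i : ℂ)) * Vᴴ)
    (hp : ∀ i, 0 ≤ p i) (hq : ∀ i, 0 ≤ q i) (ht : ∀ σ, 0 ≤ t σ) (ht1 : ∑ σ, t σ = 1)
    (hpq : ∀ i, ∑ σ, t σ * q (σ i) = p i) :
    ∃ (K : Equiv.Perm α → Matrix α α ℂ) (W : Equiv.Perm α → Matrix β β ℂ),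
      ∑ σ, (K σ)ᴴ * K σ = 1 ∧ (∀ σ, (W σ)ᴴ * W σ = 1) ∧
      ∀ σ, (WithLp.toLp 2 ((K σ ⊗ₖ W σ) *ᵥ ψ.ofLp) : EuclideanSpace ℂ (α × β)) = √(t σ) • φ := by
  have hU' : U * Uᴴ = 1 := mul_eq_one_comm.1 hU
  -- Where `p i = 0` the quotient is replaced by `1`, which keeps the measurement complete.
  let c : Equiv.Perm α → α → ℝ := fun σ i => √(t σ * if p i = 0 then 1 else q (σ i) / p i)
  have hc2 : ∀ σ i, c σ i ^ 2 = t σ * if p i = 0 then 1 else q (σ i) / p i := fun σ i => by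
    refine Real.sq_sqrt (mul_nonneg (ht σ) ?_)
    split_ifs
    · exact zero_le_one
    · exact div_nonneg (hq _) (hp i)
  have hc1 : ∀ i, ∑ σ, c σ i ^ 2 = 1 := fun i => by
    simp only [hc2]
    split_ifs with h
    · simpa using ht1
    · simp only [← mul_div_assoc]
      rw [← Finset.sum_div, hpq, div_self h]
  have hcp : ∀ σ i, c σ i * p i * c σ i = t σ * q (σ i) := fun σ i => by
    have : c σ i * p i * c σ i = c σ i ^ 2 * p i := by ring
    rw [this, hc2]
    split_ifs with h
    · have := (Finset.sum_eq_zero_iff_of_nonneg fun σ _ => mul_nonneg (ht σ) (hq (σ i))).1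
        ((hpq i).trans h) σ (Finset.mem_univ σ)
      rw [h, this, mul_zero]
    · field_simp
  let C : Equiv.Perm α → Matrix α α ℂ := fun σ => diagonal fun i => (c σ i : ℂ)
  have hC : ∀ σ, (C σ)ᴴ = C σ := fun σ => by
    simp only [C]
    rw [diagonal_conjTranspose]
    congr 1
    ext i
    simp
  let Vσ : Equiv.Perm α → Matrix α α ℂ := fun σ => V.submatrix id σ
  have hVσ : ∀ σ, (Vσ σ)ᴴ * Vσ σ = 1 := fun σ => by
    simp only [Vσ, conjTranspose_submatrix]
    rw [← submatrix_mul _ _ _ id _ Function.bijective_id, hV, submatrix_one_equiv]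
  let K : Equiv.Perm α → Matrix α α ℂ := fun σ => Vσ σ * C σ * Uᴴ
  have hK : ∑ σ, (K σ)ᴴ * K σ = 1 := by
    have h1 : ∀ σ, (K σ)ᴴ * K σ = U * diagonal (fun i => ((c σ i ^ 2 : ℝ) : ℂ)) * Uᴴ := fun σ => by
      calc (K σ)ᴴ * K σ = U * (C σ * ((Vσ σ)ᴴ * Vσ σ) * C σ) * Uᴴ := by
            simp only [K, conjTranspose_mul, conjTranspose_conjTranspose, hC, Matrix.mul_assoc]
        _ = _ := by
            rw [hVσ, mul_one]
            simp only [C, diagonal_mul_diagonal]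
            congr 3
            ext i
            push_cast
            ring
    have h2 : ∑ σ, diagonal (fun i => ((c σ i ^ 2 : ℝ) : ℂ)) = 1 := by
      ext i j
      rw [Matrix.sum_apply]
      by_cases hij : i = j
      · subst hij
        simp only [diagonal_apply_eq, one_apply_eq]
        rw [← Complex.ofReal_sum, hc1, Complex.ofReal_one]
      · simp [hij]
    simp only [h1]
    rw [← Finset.sum_mul, ← Finset.mul_sum, h2, mul_one, hU']
  have hKψ : ∀ σ, (K σ * coeffMatrix ψ) * (K σ * coeffMatrix ψ)ᴴ
      = ((√(t σ) : ℂ) • coeffMatrix φ) * ((√(t σ) : ℂ) • coeffMatrix φ)ᴴ := fun σ => by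
    calc _ = Vσ σ * C σ * Uᴴ * (coeffMatrix ψ * (coeffMatrix ψ)ᴴ) * (U * C σ * (Vσ σ)ᴴ) := by
          simp only [K, conjTranspose_mul, conjTranspose_conjTranspose, hC, Matrix.mul_assoc]
      _ = Vσ σ * (C σ * (Uᴴ * U) * diagonal (fun i => (p i : ℂ)) * (Uᴴ * U) * C σ) * (Vσ σ)ᴴ := by
          rw [hψ]
          simp only [Matrix.mul_assoc]
      _ = Vσ σ * ((t σ : ℂ) • (diagonal fun i => (q i : ℂ)).submatrix σ σ) * (Vσ σ)ᴴ := by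
          rw [hU, mul_one, mul_one, submatrix_diagonal_equiv]
          simp only [C, diagonal_mul_diagonal]
          congr 2
          rw [← diagonal_smul]
          congr 1
          ext i
          simp only [Pi.smul_apply, Function.comp_apply, smul_eq_mul]
          exact_mod_cast hcp σ i
      _ = (t σ : ℂ) • (V * diagonal (fun i => (q i : ℂ)) * Vᴴ) := by
          rw [Matrix.mul_smul, Matrix.smul_mul]
          simp only [Vσ, conjTranspose_submatrix, submatrix_mul_equiv, submatrix_id_id]
      _ = _ := by
          rw [← hφ, conjTranspose_smul, Matrix.smul_mul, Matrix.mul_smul, smul_smul]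
          congr 1
          rw [Complex.star_def, Complex.conj_ofReal, ← Complex.ofReal_mul,
            Real.mul_self_sqrt (ht σ)]
  choose W hW hKW using fun σ => exists_unitary_mul_eq _ _ (hKψ σ)
  refine ⟨K, fun σ => (W σ)ᵀ, hK, fun σ => ?_, fun σ => ?_⟩
  · have h := congrArg transpose (hW σ)
    rwa [transpose_mul, transpose_one] at h
  · apply coeffMatrix_injective
    rw [coeffMatrix_kronecker_mulVec, transpose_transpose, hKW]
    ext i k
    simp [coeffMatrix]

end OneShot

/-! ### Schmidt coefficients and approximate one-shot conversion -/

theorem isHermitian_reducedA_pureDensity {α β : Type*} [Fintype β]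
    (ψ : EuclideanSpace ℂ (α × β)) : (reducedA (pureDensity ψ)).IsHermitian := by
  rw [reducedA_pureDensity]
  exact isHermitian_mul_conjTranspose_self _

section Eigenvalues

variable {α β : Type*} [Fintype α] [DecidableEq α] [Fintype β] (ψ : EuclideanSpace ℂ (α × β))

/-- The squared Schmidt coefficients of a bipartite vector: the eigenvalues of its reduced
operator on the first factor. -/
noncomputable def schmidt : α → ℝ :=
  (isHermitian_reducedA_pureDensity ψ).eigenvalues

open scoped ComplexOrder in
theorem schmidt_nonneg (i : α) : 0 ≤ schmidt ψ i := by
  refine Matrix.PosSemidef.eigenvalues_nonneg (A := reducedA (pureDensity ψ)) ?_ i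
  rw [reducedA_pureDensity]
  exact posSemidef_self_mul_conjTranspose _

theorem sum_schmidt : ∑ i, schmidt ψ i = ‖ψ‖ ^ 2 := by
  apply Complex.ofReal_injective
  rw [norm_sq_eq_trace, ← reducedA_pureDensity,
    (isHermitian_reducedA_pureDensity ψ).trace_eq_sum_eigenvalues, Complex.ofReal_sum]
  rfl

theorem exists_unitary_coeffMatrix_mul_conjTranspose :
    ∃ U : Matrix α α ℂ, Uᴴ * U = 1 ∧ coeffMatrix ψ * (coeffMatrix ψ)ᴴ
      = U * diagonal (fun i => (schmidt ψ i : ℂ)) * Uᴴ := by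
  refine ⟨(isHermitian_reducedA_pureDensity ψ).eigenvectorUnitary, Unitary.coe_star_mul_self _, ?_⟩
  rw [← reducedA_pureDensity]
  exact (isHermitian_reducedA_pureDensity ψ).spectral_theorem

theorem re_trace_reducedA_mul_posProj_sub (c : ℝ) :
    (reducedA (pureDensity ψ)
        * posProj (reducedA (pureDensity ψ) - c • (1 : Matrix α α ℂ))).trace.re
      = ∑ i with c < schmidt ψ i, schmidt ψ i := by
  rw [re_trace_mul_posProj_sub (isHermitian_reducedA_pureDensity ψ), Finset.sum_filter]
  rfl

end Eigenvalues

/-- One-shot conversion. If the Schmidt weight of `ψ` above `s` is `ε`, that of `φ` above `r` is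
`1 - δ`, and `s ≤ r (1 - ε)`, then some LOCC map takes `ψ` to `φ` up to `4 √(ε + δ)`. The
truncation of `ψ` to its coefficients at most `s` has coefficients at most `s / (1 - ε) ≤ r`, and
at most `1 / r` coefficients of `φ` exceed `r`, so that the truncations convert exactly. -/
theorem exists_isLOCC_sq_traceNorm_le {a b : ℕ} {ψ φ : EuclideanSpace ℂ (Fin a × Fin b)}
    (hψ : ‖ψ‖ = 1) (hφ : ‖φ‖ = 1) {s r ε δ : ℝ}
    (hε : ∑ i with s < schmidt ψ i, schmidt ψ i = ε)
    (hδ : ∑ i with r < schmidt φ i, schmidt φ i = 1 - δ)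
    (hε1 : ε < 1) (hδ1 : δ < 1) (hsr : s ≤ r * (1 - ε)) :
    ∃ L : Matrix (Fin a × Fin b) (Fin a × Fin b) ℂ → Matrix (Fin a × Fin b) (Fin a × Fin b) ℂ,
      IsLOCC L ∧ traceNorm (L (pureDensity ψ) - pureDensity φ) ^ 2 ≤ 16 * (ε + δ) := by
  have hp := schmidt_nonneg ψ
  have hq := schmidt_nonneg φ
  have hp1 : ∑ i, schmidt ψ i = 1 := by rw [sum_schmidt, hψ, one_pow]
  have hq1 : ∑ i, schmidt φ i = 1 := by rw [sum_schmidt, hφ, one_pow]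
  obtain ⟨U, hU, hψU⟩ := exists_unitary_coeffMatrix_mul_conjTranspose ψ
  obtain ⟨V, hV, hφV⟩ := exists_unitary_coeffMatrix_mul_conjTranspose φ
  let S : Finset (Fin a) := {i | ¬ s < schmidt ψ i}
  let T : Finset (Fin a) := {i | r < schmidt φ i}
  have hS : ∑ i ∈ S, schmidt ψ i = 1 - ε := by
    rw [← hp1, ← hε, ← Finset.sum_filter_add_sum_filter_not Finset.univ (s < schmidt ψ ·)]
    simp [S]
  have hT : ∑ i ∈ T, schmidt φ i = 1 - δ := hδ
  obtain ⟨ψ', hψ', hψd⟩ := exists_truncation hU hψU hp hp1 S (by linarith)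
  obtain ⟨φ', hφ', hφd⟩ := exists_truncation hV hφV hq hq1 T (by linarith)
  rw [hS] at hψ' hψd
  rw [hT] at hφ' hφd
  have hp' : ∀ i, 0 ≤ if i ∈ S then schmidt ψ i / (1 - ε) else 0 := fun i => by
    split_ifs
    · exact div_nonneg (hp i) (by linarith)
    · exact le_rfl
  have hq' : ∀ i, 0 ≤ if i ∈ T then schmidt φ i / (1 - δ) else 0 := fun i => by
    split_ifs
    · exact div_nonneg (hq i) (by linarith)
    · exact le_rfl
  have hTr : T.card * r ≤ 1 := by
    have h1 : T.card • r ≤ ∑ i ∈ T, schmidt φ i :=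
      Finset.card_nsmul_le_sum _ _ _ fun i hi => (Finset.mem_filter.1 hi).2.le
    have h2 : ∑ i ∈ T, schmidt φ i ≤ 1 := hq1 ▸ Finset.sum_le_univ_sum_of_nonneg hq
    rw [nsmul_eq_mul] at h1
    exact h1.trans h2
  obtain ⟨t, ht, ht1, htpq⟩ := exists_perm_mixture
    (p := fun i => if i ∈ S then schmidt ψ i / (1 - ε) else 0)
    (q := fun i => if i ∈ T then schmidt φ i / (1 - δ) else 0) T hp'
    (by rw [← Finset.sum_filter, Finset.filter_mem_eq_inter, Finset.univ_inter, ← Finset.sum_div,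
          hS, div_self (by linarith)])
    (fun i => by
      split_ifs with hi
      · refine le_trans (mul_le_mul_of_nonneg_left ?_ (Nat.cast_nonneg _)) hTr
        rw [div_le_iff₀ (by linarith)]
        exact (not_lt.1 (Finset.mem_filter.1 hi).2).trans hsr
      · simp)
    (fun i hi => if_neg hi)
    (by rw [← Finset.sum_filter, Finset.filter_mem_eq_inter, Finset.univ_inter, ← Finset.sum_div,
          hT, div_self (by linarith)])
  obtain ⟨K, W, hK, hW, hKW⟩ :=
    exists_kraus_of_perm_mixture hU hV hψ' hφ' hp' hq' ht ht1 htpq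
  refine ⟨_, isLOCC_measure_correct K W hK hW, ?_⟩
  let v (σ : Equiv.Perm (Fin a)) (x : EuclideanSpace ℂ (Fin a × Fin b)) :
      EuclideanSpace ℂ (Fin a × Fin b) := WithLp.toLp 2 ((K σ ⊗ₖ W σ) *ᵥ x.ofLp)
  have hKWsum : ∑ σ, (K σ ⊗ₖ W σ)ᴴ * (K σ ⊗ₖ W σ) = 1 := by
    have h1 : ∀ σ, (K σ ⊗ₖ W σ)ᴴ * (K σ ⊗ₖ W σ)
        = ((K σ)ᴴ * K σ) ⊗ₖ (1 : Matrix (Fin b) (Fin b) ℂ) := fun σ => by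
      rw [conjTranspose_kronecker, ← mul_kronecker_mul, hW]
    simp only [h1]
    rw [← one_kronecker_one, ← hK]
    ext i j
    simp [Matrix.sum_apply, Finset.sum_mul]
  have hv : ∀ x, ∑ σ, ‖v σ x‖ ^ 2 = ‖x‖ ^ 2 := sum_norm_sq_mulVec _ hKWsum
  have hw : ∀ x : EuclideanSpace ℂ (Fin a × Fin b), ∑ σ, ‖√(t σ) • x‖ ^ 2 = ‖x‖ ^ 2 := fun x => by
    have : ∀ σ, ‖√(t σ) • x‖ ^ 2 = t σ * ‖x‖ ^ 2 := fun σ => by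
      rw [norm_smul, mul_pow, Real.norm_eq_abs, sq_abs, Real.sq_sqrt (ht σ)]
    simp only [this]
    rw [← Finset.sum_mul, ht1, one_mul]
  have hφsum : pureDensity φ = ∑ σ, pureDensity (√(t σ) • φ) := by
    simp only [pureDensity_smul, Real.sq_sqrt (ht _)]
    rw [← Finset.sum_smul, ht1, one_smul]
  have hdiff : ∑ σ, ‖v σ ψ - √(t σ) • φ‖ ^ 2 ≤ 4 * (ε + δ) := by
    -- On the truncations the branches agree exactly, so only the truncation errors remain.
    have h1 : ∀ σ, v σ ψ - √(t σ) • φ = v σ (ψ - ψ') - √(t σ) • (φ - φ') := fun σ => by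
      have h2 : v σ (ψ - ψ') = v σ ψ - v σ ψ' := by
        simp only [v, WithLp.ofLp_sub, mulVec_sub, WithLp.toLp_sub]
      have h3 : v σ ψ' = √(t σ) • φ' := hKW σ
      rw [h2, h3, smul_sub]
      abel
    calc ∑ σ, ‖v σ ψ - √(t σ) • φ‖ ^ 2
        ≤ ∑ σ, 2 * (‖v σ (ψ - ψ')‖ ^ 2 + ‖√(t σ) • (φ - φ')‖ ^ 2) := by
          refine Finset.sum_le_sum fun σ _ => ?_
          rw [h1]
          exact (pow_le_pow_left₀ (norm_nonneg _) (norm_sub_le _ _) 2).trans add_sq_le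
      _ = 2 * (‖ψ - ψ'‖ ^ 2 + ‖φ - φ'‖ ^ 2) := by
          rw [← Finset.mul_sum, Finset.sum_add_distrib, hv, hw]
      _ ≤ 4 * (ε + δ) := by linarith
  have hmain := sq_traceNorm_sum_pureDensity_sub_le (fun σ => v σ ψ) fun σ => √(t σ) • φ
  rw [hv, hw, hψ, hφ, ← hφsum] at hmain
  simp only [mul_pureDensity_mul]
  linarith

/-! ### Asymptotics -/

theorem tendsto_of_limsup_coe_le {f : ℕ → ℝ} {c : ℝ} (hf : ∀ n, c ≤ f n)
    (h : limsup (fun n => (f n : EReal)) atTop ≤ (c : EReal)) : Tendsto f atTop (𝓝 c) := by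
  refine EReal.tendsto_coe.1 (tendsto_of_le_liminf_of_limsup_le ?_ h)
  exact le_liminf_of_le (h := Eventually.of_forall fun n => EReal.coe_le_coe_iff.2 (hf n))

theorem tendsto_of_le_liminf_coe {f : ℕ → ℝ} {c : ℝ} (hf : ∀ n, f n ≤ c)
    (h : (c : EReal) ≤ liminf (fun n => (f n : EReal)) atTop) : Tendsto f atTop (𝓝 c) := by
  refine EReal.tendsto_coe.1 (tendsto_of_le_liminf_of_limsup_le h ?_)
  exact limsup_le_of_le (h := Eventually.of_forall fun n => EReal.coe_le_coe_iff.2 (hf n))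

/-- A gap between the entropy rates provides two exponents `x < y` such that asymptotically the
spectrum of `ρ` lies below `exp (n x)` and that of `σ` above `exp (n y)`. -/
theorem exists_exponents_of_supEntropyRate_lt {d : ℕ → ℕ}
    {ρ σ : ∀ n, Matrix (Fin (d n)) (Fin (d n)) ℂ}
    (h : supEntropyRate 0 σ < infEntropyRate 0 ρ) :
    ∃ x y : ℝ, x < y ∧
      limsup (fun n => (spectralProb ρ (fun _ => 1) x n : EReal)) atTop ≤ ((0 : ℝ) : EReal) ∧
      ((1 : ℝ) : EReal) ≤ liminf (fun n => (spectralProb σ (fun _ => 1) y n : EReal)) atTop := by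
  rw [supEntropyRate, infEntropyRate, EReal.neg_lt_neg_iff, supDivergenceRate,
    infDivergenceRate] at h
  obtain ⟨_, ⟨x, hx, rfl⟩, hx'⟩ := sInf_lt_iff.1 h
  obtain ⟨_, ⟨y, hy, rfl⟩, hy'⟩ := lt_sSup_iff.1 hx'
  refine ⟨x, y, EReal.coe_lt_coe_iff.1 hy', hx, ?_⟩
  simpa using hy

end EntanglementConversion

open EntanglementConversion in
theorem theorem1 (dA dB : ℕ → ℕ)
    (ψ φ : ∀ n, EuclideanSpace ℂ (Fin (dA n) × Fin (dB n)))
    (hψ : ∀ n, ‖ψ n‖ = 1) (hφ : ∀ n, ‖φ n‖ = 1)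
    (hH : EntanglementConversion.supEntropyRate 0
            (fun n => EntanglementConversion.reducedA (EntanglementConversion.pureDensity (φ n)))
        < EntanglementConversion.infEntropyRate 0
            (fun n => EntanglementConversion.reducedA (EntanglementConversion.pureDensity (ψ n)))) :
    EntanglementConversion.AsympConvertible ψ φ := by
  obtain ⟨x, y, hxy, hx, hy⟩ := exists_exponents_of_supEntropyRate_lt hH
  let f : ℕ → ℝ := fun n =>
    ∑ i with Real.exp (n * x) < schmidt (ψ n) i, schmidt (ψ n) i
  let g : ℕ → ℝ := fun n =>
    ∑ i with Real.exp (n * y) < schmidt (φ n) i, schmidt (φ n) i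
  have hf : Tendsto f atTop (𝓝 0) := by
    refine tendsto_of_limsup_coe_le (fun n => Finset.sum_nonneg fun i _ => schmidt_nonneg _ i) ?_
    simpa only [spectralProb, re_trace_reducedA_mul_posProj_sub] using hx
  have hg : Tendsto g atTop (𝓝 1) := by
    refine tendsto_of_le_liminf_coe (fun n => ?_) ?_
    · have h1 : ∑ i, schmidt (φ n) i = 1 := by rw [sum_schmidt, hφ, one_pow]
      rw [← h1]
      exact Finset.sum_le_univ_sum_of_nonneg (schmidt_nonneg _)
    · simpa only [spectralProb, re_trace_reducedA_mul_posProj_sub] using hy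
  have hev : ∀ᶠ n in atTop, ∃ L, IsLOCC L ∧
      traceNorm (L (pureDensity (ψ n)) - pureDensity (φ n)) ^ 2 ≤ 16 * (f n + (1 - g n)) := by
    have hexp : Tendsto (fun n : ℕ => Real.exp (n * (x - y))) atTop (𝓝 0) :=
      Real.tendsto_exp_atBot.comp
        (tendsto_natCast_atTop_atTop.atTop_mul_const_of_neg (sub_neg.2 hxy))
    filter_upwards [hf.eventually_lt_const (show (0 : ℝ) < 1 / 2 by norm_num),
      hg.eventually_const_lt (show (0 : ℝ) < 1 by norm_num),
      hexp.eventually_lt_const (show (0 : ℝ) < 1 / 2 by norm_num)] with n hfn hgn hen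
    refine exists_isLOCC_sq_traceNorm_le (hψ n) (hφ n) (s := Real.exp (n * x))
      (r := Real.exp (n * y)) rfl (by simp [g]) (by linarith) (by linarith) ?_
    have hsplit : Real.exp (n * x) = Real.exp (n * y) * Real.exp (n * (x - y)) := by
      rw [← Real.exp_add]
      ring_nf
    rw [hsplit]
    exact mul_le_mul_of_nonneg_left (by linarith) (Real.exp_pos _).le
  -- At the finitely many other `n` any LOCC map will do, for instance the identity.
  have hex : ∀ n, ∃ L, IsLOCC L ∧ ((∃ L, IsLOCC L ∧
      traceNorm (L (pureDensity (ψ n)) - pureDensity (φ n)) ^ 2 ≤ 16 * (f n + (1 - g n))) →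
      traceNorm (L (pureDensity (ψ n)) - pureDensity (φ n)) ^ 2 ≤ 16 * (f n + (1 - g n))) := by
    intro n
    by_cases h : ∃ L, IsLOCC L ∧
        traceNorm (L (pureDensity (ψ n)) - pureDensity (φ n)) ^ 2 ≤ 16 * (f n + (1 - g n))
    · obtain ⟨L, hL, hL'⟩ := h
      exact ⟨L, hL, fun _ => hL'⟩
    · exact ⟨_, IsLOCC.nil, fun h' => absurd h' h⟩
  choose L hL hLn using hex
  refine ⟨L, hL, ?_⟩
  have hlim : Tendsto (fun n => √(16 * (f n + (1 - g n)))) atTop (𝓝 0) := by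
    have h1 : Tendsto (fun n => √(16 * (f n + (1 - g n)))) atTop
        (𝓝 √(16 * (0 + (1 - 1)))) :=
      ((hf.add (hg.const_sub 1)).const_mul 16).sqrt
    simpa using h1
  exact squeeze_zero_norm' (hev.mono fun n hn => Real.abs_le_sqrt (hLn n hn)) hlim
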